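/- Let $m\ge 2$ be an integer, let $a_1,\dots,a_m$ be real constants, let $I\subseteq\mathbb{R}$ be an open interval and let $f:I\to(0,\infty)$ be a smooth function. Equip $\mathbb{R}^m\times I\subseteq\mathbb{R}^{m+1}$ (coordinates $x_1,\dots,x_m,z$) with the conformally flat metric $h=f(z)^{-2}\big(\sum_{i=1}^m dx_i^2+dz^2\big)$. For $c\in\mathbb{R}$ let $U_c=\{x\in\mathbb{R}^m:\sum_i a_ix_i+c\in I\}$ and let $\varphi_c:U_c\to(\mathbb{R}^m\times I,h)$, $\varphi_c(x)=(x_1,\dots,x_m,\sum_{i} a_ix_i+c)$, where $U_c$ carries the induced metric $g=\varphi_c^*h$, so that $\varphi_c$ is an isometric immersion. A map $\varphi:(M,g)\to(N,h)$ is called harmonic if its tension field $\tau(\varphi)=\mathrm{Trace}_g\nabla d\varphi$ vanishes, biharmonic if $$\mathrm{Trace}_g(\nabla^{\varphi}\nabla^{\varphi}-\nabla^{\varphi}_{\nabla^M})\tau(\varphi)-\mathrm{Trace}_g R^N(d\varphi,\tau(\varphi))d\varphi=0,$$ where $R^N(X,Y)Z=[\nabla^N_X,\nabla^N_Y]Z-\nabla^N_{[X,Y]}Z$,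 and proper biharmonic if it is biharmonic and not harmonic. Consider the three cases (i) $f'=0$ on $I$; (ii) $m=4$ and, on $I$, $f$ satisfies $$\Big(\sum_{i=1}^4a_i^2\Big)f^2f'''+\Big(4-\sum_{i=1}^4a_i^2\Big)ff'f''-4\Big(2+\sum_{i=1}^4a_i^2\Big)(f')^3=0;$$ (iii) $a_1=\dots=a_m=0$ and $f(z)=\frac{1}{Az+B}$ on $I$ for some constants $A\neq 0$ and $B$. Then: 1. If $a_i\ne 0$ for some $i$, then for every single $c\in\mathbb{R}$ the immersion $\varphi_c$ is biharmonic if and only if one of (i), (ii), (iii) holds. 2. For arbitrary $a_1,\dots,a_m$, all the parallel hyperplanes $\varphi_c$, $c\in\mathbb{R}$, are biharmonic if and only if one of (i), (ii), (iii) holds. 3. In case (i) every $\varphi_c$ is harmonic (minimal), and indeed totally geodesic. 4. In case (iii) every $\varphi_c$ with $c\in I$ is proper biharmonic. 5. In general (without assuming biharmonicity), every $\varphi_c$ is totally umbilical. With $k_m=\big(1+\sum_{i}a_i^2\big)^{-1/2}$, the vector field $\xi=k_mf(z)\big(\sum_i a_i\partial_{x_i}-\partial_z\big)$ along $\varphi_c$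 is a unit normal field, and the mean curvature vector $\frac1m\mathrm{Trace}_g\nabla d\varphi_c$ equals $H\xi$ with $H=-k_mf'$, where $f$ and $f'$ are evaluated at $z=\sum_ia_ix_i+c$. -/

import Mathlib

open scoped ContDiff

namespace BiharmonicMap

noncomputable section

/-! Riemannian geometry of maps between open sets of coordinate spaces `ι → ℝ`, `κ → ℝ`, written in
the global coordinates. All notions below are local: at a point of an open set they depend only on
the germs of the metrics and of the map. -/

/-- The partial derivative `∂ᵢ u`. -/
def pd {ι : Type*} [Fintype ι] [DecidableEq ι] (i : ι) (u : (ι → ℝ) → ℝ) (x : ι → ℝ) : ℝ :=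
  fderiv ℝ u x (Pi.single i 1)

/-- The components `g_{ij}` of a metric in the coordinates, as a function of the point. -/
abbrev MetricField (ι : Type*) := (ι → ℝ) → Matrix ι ι ℝ

/-- The Christoffel symbol `Γᵏᵢⱼ` of the Levi-Civita connection of `g`. -/
def christoffel {ι : Type*} [Fintype ι] [DecidableEq ι] (g : MetricField ι) (k i j : ι)
    (x : ι → ℝ) : ℝ :=
  (1 / 2) * ∑ l, (g x)⁻¹ k l *
    (pd i (fun y => g y j l) x + pd j (fun y => g y i l) x - pd l (fun y => g y i j) x)

/-- The component along `∂ₗ` of `R(∂ᵢ, ∂ⱼ)∂ₖ`, where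
`R(X, Y)Z = ∇_X ∇_Y Z - ∇_Y ∇_X Z - ∇_[X, Y] Z`. -/
def curvature {ι : Type*} [Fintype ι] [DecidableEq ι] (g : MetricField ι) (l i j k : ι)
    (x : ι → ℝ) : ℝ :=
  pd i (christoffel g l j k) x - pd j (christoffel g l i k) x
    + ∑ p, (christoffel g l i p x * christoffel g p j k x
        - christoffel g l j p x * christoffel g p i k x)

/-- The vector `R(X, Y)Z` for tangent vectors `X, Y, Z` at the point `x`. -/
def curvatureOp {ι : Type*} [Fintype ι] [DecidableEq ι] (g : MetricField ι) (x : ι → ℝ)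
    (X Y Z : ι → ℝ) : ι → ℝ :=
  fun l => ∑ i, ∑ j, ∑ k, curvature g l i j k x * X i * Y j * Z k

/-- The vector `dφ(∂ᵢ)`. -/
def dmap {ι κ : Type*} [Fintype ι] [DecidableEq ι] (φ : (ι → ℝ) → (κ → ℝ)) (i : ι)
    (x : ι → ℝ) : κ → ℝ :=
  fun α => pd i (fun y => φ y α) x

/-- The induced metric `φ^* h`. -/
def pullbackMetric {ι κ : Type*} [Fintype ι] [DecidableEq ι] [Fintype κ]
    (h : MetricField κ) (φ : (ι → ℝ) → (κ → ℝ)) : MetricField ι :=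
  fun x => Matrix.of fun i j => ∑ α, ∑ β, h (φ x) α β * dmap φ i x α * dmap φ j x β

/-- The covariant derivative `∇^φ_{∂ᵢ} V` of a vector field `V` along `φ`, for the pull-back by `φ`
of the Levi-Civita connection of `h`. -/
def covAlong {ι κ : Type*} [Fintype ι] [DecidableEq ι] [Fintype κ] [DecidableEq κ]
    (h : MetricField κ) (φ : (ι → ℝ) → (κ → ℝ)) (i : ι) (V : (ι → ℝ) → (κ → ℝ))
    (x : ι → ℝ) : κ → ℝ :=
  fun α => pd i (fun y => V y α) x
    + ∑ β, ∑ γ, christoffel h α β γ (φ x) * dmap φ i x β * V x γ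

/-- The second fundamental form `(∇dφ)(∂ᵢ, ∂ⱼ) = ∇^φ_{∂ᵢ} dφ(∂ⱼ) - dφ(∇_{∂ᵢ} ∂ⱼ)` of the map
`φ : (M, g) → (N, h)`. -/
def secondFundForm {ι κ : Type*} [Fintype ι] [DecidableEq ι] [Fintype κ] [DecidableEq κ]
    (g : MetricField ι) (h : MetricField κ) (φ : (ι → ℝ) → (κ → ℝ)) (i j : ι)
    (x : ι → ℝ) : κ → ℝ :=
  covAlong h φ i (dmap φ j) x - ∑ k, christoffel g k i j x • dmap φ k x

/-- The tension field `τ(φ) = Trace_g ∇dφ`. -/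
def tension {ι κ : Type*} [Fintype ι] [DecidableEq ι] [Fintype κ] [DecidableEq κ]
    (g : MetricField ι) (h : MetricField κ) (φ : (ι → ℝ) → (κ → ℝ)) (x : ι → ℝ) : κ → ℝ :=
  ∑ i, ∑ j, (g x)⁻¹ i j • secondFundForm g h φ i j x

/-- `Trace_g (∇^φ ∇^φ - ∇^φ_{∇^M}) V` for a vector field `V` along `φ`. -/
def roughLaplacian {ι κ : Type*} [Fintype ι] [DecidableEq ι] [Fintype κ] [DecidableEq κ]
    (g : MetricField ι) (h : MetricField κ) (φ : (ι → ℝ) → (κ → ℝ)) (V : (ι → ℝ) → (κ → ℝ))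
    (x : ι → ℝ) : κ → ℝ :=
  ∑ i, ∑ j, (g x)⁻¹ i j •
    (covAlong h φ i (covAlong h φ j V) x - ∑ k, christoffel g k i j x • covAlong h φ k V x)

/-- The bitension field
`τ²(φ) = Trace_g (∇^φ ∇^φ - ∇^φ_{∇^M}) τ(φ) - Trace_g R^N(dφ, τ(φ)) dφ`. -/
def bitension {ι κ : Type*} [Fintype ι] [DecidableEq ι] [Fintype κ] [DecidableEq κ]
    (g : MetricField ι) (h : MetricField κ) (φ : (ι → ℝ) → (κ → ℝ)) (x : ι → ℝ) : κ → ℝ :=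
  roughLaplacian g h φ (tension g h φ) x
    - ∑ i, ∑ j, (g x)⁻¹ i j • curvatureOp h (φ x) (dmap φ i x) (tension g h φ x) (dmap φ j x)

/-- `φ : (U, g) → (N, h)` is a harmonic map. -/
def IsHarmonicOn {ι κ : Type*} [Fintype ι] [DecidableEq ι] [Fintype κ] [DecidableEq κ]
    (g : MetricField ι) (h : MetricField κ) (φ : (ι → ℝ) → (κ → ℝ)) (U : Set (ι → ℝ)) : Prop :=
  ContDiffOn ℝ ∞ φ U ∧ ∀ x ∈ U, tension g h φ x = 0

/-- `φ : (U, g) → (N, h)` is a biharmonic map. -/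
def IsBiharmonicOn {ι κ : Type*} [Fintype ι] [DecidableEq ι] [Fintype κ] [DecidableEq κ]
    (g : MetricField ι) (h : MetricField κ) (φ : (ι → ℝ) → (κ → ℝ)) (U : Set (ι → ℝ)) : Prop :=
  ContDiffOn ℝ ∞ φ U ∧ ∀ x ∈ U, bitension g h φ x = 0

/-- `φ : (U, g) → (N, h)` is proper biharmonic: biharmonic and not harmonic. -/
def IsProperBiharmonicOn {ι κ : Type*} [Fintype ι] [DecidableEq ι] [Fintype κ] [DecidableEq κ]
    (g : MetricField ι) (h : MetricField κ) (φ : (ι → ℝ) → (κ → ℝ)) (U : Set (ι → ℝ)) : Prop :=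
  IsBiharmonicOn g h φ U ∧ ¬ IsHarmonicOn g h φ U

/-- `φ : (U, g) → (N, h)` is totally geodesic: `∇dφ = 0`. -/
def IsTotallyGeodesicOn {ι κ : Type*} [Fintype ι] [DecidableEq ι] [Fintype κ] [DecidableEq κ]
    (g : MetricField ι) (h : MetricField κ) (φ : (ι → ℝ) → (κ → ℝ)) (U : Set (ι → ℝ)) : Prop :=
  ∀ x ∈ U, ∀ i j, secondFundForm g h φ i j x = 0

/-- The mean curvature vector `η = (1 / m) Trace_g ∇dφ` of an immersion `φ` of an `m`-dimensional
domain, with its induced metric `g = φ^* h`. -/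
def meanCurvatureVector {ι κ : Type*} [Fintype ι] [DecidableEq ι] [Fintype κ] [DecidableEq κ]
    (h : MetricField κ) (φ : (ι → ℝ) → (κ → ℝ)) (x : ι → ℝ) : κ → ℝ :=
  (Fintype.card ι : ℝ)⁻¹ • tension (pullbackMetric h φ) h φ x

/-- The immersion `φ` is totally umbilical: its second fundamental form is `g ⊗ η`, with `g = φ^* h`
the induced metric and `η` the mean curvature vector. -/
def IsTotallyUmbilicalOn {ι κ : Type*} [Fintype ι] [DecidableEq ι] [Fintype κ] [DecidableEq κ]
    (h : MetricField κ) (φ : (ι → ℝ) → (κ → ℝ)) (U : Set (ι → ℝ)) : Prop :=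
  ∀ x ∈ U, ∀ i j, secondFundForm (pullbackMetric h φ) h φ i j x
    = pullbackMetric h φ x i j • meanCurvatureVector h φ x

/-- `ξ` is a unit normal vector of the immersion `φ` at the point `φ x`. -/
def IsUnitNormalAt {ι κ : Type*} [Fintype ι] [DecidableEq ι] [Fintype κ]
    (h : MetricField κ) (φ : (ι → ℝ) → (κ → ℝ)) (x : ι → ℝ) (ξ : κ → ℝ) : Prop :=
  (∑ α, ∑ β, h (φ x) α β * ξ α * ξ β = 1) ∧
    ∀ i, ∑ α, ∑ β, h (φ x) α β * ξ α * dmap φ i x β = 0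

/-- The conformally flat metric `f(z)⁻² (dx₁² + ⋯ + dx_m² + dz²)`; the last coordinate is `z`. -/
def conformalMetric (m : ℕ) (f : ℝ → ℝ) : MetricField (Fin (m + 1)) :=
  fun y => (f (y (Fin.last m)) ^ 2)⁻¹ • (1 : Matrix (Fin (m + 1)) (Fin (m + 1)) ℝ)

/-- The value `a₁ x₁ + ⋯ + a_m x_m + c`. -/
def height {m : ℕ} (a : Fin m → ℝ) (c : ℝ) (x : Fin m → ℝ) : ℝ := ∑ i, a i * x i + c

/-- The parametrization `x ↦ (x, a₁ x₁ + ⋯ + a_m x_m + c)` of a hyperplane. -/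
def hyperplane {m : ℕ} (a : Fin m → ℝ) (c : ℝ) (x : Fin m → ℝ) : Fin (m + 1) → ℝ :=
  Fin.snoc (α := fun _ => ℝ) x (height a c x)

/-- The set of those `x` for which `(x, a₁ x₁ + ⋯ + a_m x_m + c)` lies in `ℝᵐ × I`. -/
def hyperplaneDomain {m : ℕ} (a : Fin m → ℝ) (c : ℝ) (I : Set ℝ) : Set (Fin m → ℝ) :=
  {x | height a c x ∈ I}

/-- The number `k_m = (1 + a₁² + ⋯ + a_m²)^{-1/2}`. -/
def normalFactor {m : ℕ} (a : Fin m → ℝ) : ℝ := 1 / Real.sqrt (1 + ∑ i, a i ^ 2)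

/-- The vector `k_m f(z) (a₁ ∂₁ + ⋯ + a_m ∂_m - ∂_z)` at height `z`. -/
def hyperplaneNormal {m : ℕ} (a : Fin m → ℝ) (f : ℝ → ℝ) (z : ℝ) : Fin (m + 1) → ℝ :=
  (normalFactor a * f z) • Fin.snoc (α := fun _ => ℝ) a (-1)

/-- The constant case: `f' = 0`. -/
def CaseConst (f : ℝ → ℝ) (I : Set ℝ) : Prop := ∀ z ∈ I, deriv f z = 0

/-- The four-dimensional case: `m = 4` and the third order equation for `f`. -/
def CaseODE {m : ℕ} (a : Fin m → ℝ) (f : ℝ → ℝ) (I : Set ℝ) : Prop :=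
  m = 4 ∧ ∀ z ∈ I,
    (∑ i, a i ^ 2) * f z ^ 2 * iteratedDeriv 3 f z
      + (4 - ∑ i, a i ^ 2) * f z * deriv f z * iteratedDeriv 2 f z
      - 4 * (2 + ∑ i, a i ^ 2) * deriv f z ^ 3 = 0

/-- The reciprocal case: all `aᵢ` vanish and `f(z) = 1 / (A z + B)` with constants `A ≠ 0` and `B`. -/
def CaseReciprocal {m : ℕ} (a : Fin m → ℝ) (f : ℝ → ℝ) (I : Set ℝ) : Prop :=
  (∀ i, a i = 0) ∧ ∃ A B : ℝ, A ≠ 0 ∧ ∀ z ∈ I, A * z + B ≠ 0 ∧ f z = 1 / (A * z + B)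

end

end BiharmonicMap

open BiharmonicMap

/-! ### Locality of derivatives, and Christoffel symbols of conformal metrics. -/

namespace BiharmonicMap
open Filter Topology

/-! Write `S` for the sum of the `a i ^ 2`, `e i` for the constant tangent vectors `tangentVec a i`,
`ν` for the Euclidean normal `normalVec a`, and `G` for `euclidGram a`. Both the ambient and the
induced metric are a constant metric divided by the square of `f(z)`, so every coefficient depends
on the height `z` alone. Moving to the conformal metric keeps the hyperplane umbilical: its second
fundamental form is `-(f'/f) (1 + S)⁻¹ G ⊗ ν` (`secondFundForm_hyperplane`), so the tension is a
multiple of `f f' ν` (`tension_hyperplane`). This already gives the claims on harmonicity, total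
geodesy, umbilicity and mean curvature.

Differentiating the tension twice (`roughLaplacian_tension_hyperplane`) and tracing the curvature
(`sum_curvatureOp_hyperplane`) yields, up to a nonvanishing factor, the bitension `D ν + C ∑ a i e
i` (`bitension_hyperplane`). Here `D = S f² f''' + (m + (3 - m) S) f f' f'' - m (2 + S) f'³` and `C
= (4 - m) f f' f''`. The two terms are the normal and the tangential part, so biharmonicity means `D
= 0` and `C a i = 0` for every `i`.

The equations are solved in `forall_biharmonic_equation_iff`. If `a = 0`, then `D = m f' (f f'' - 2
f'²)`, which forces `1 / f` to be affine unless `f` is constant. If `m = 4`, then `C = 0` and `D =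
0` is the stated third order equation. Otherwise `f' f'' = 0`; near a point with `f' ≠ 0` this gives
`f'' = f''' = 0`, and `D = 0` then contradicts `f' ≠ 0`. A slanted hyperplane meets every height in
`I`, so a single one sees the whole equation; a horizontal one sees only `z = c`, so the family is
needed. -/

lemma pd_congr {ι : Type*} [Fintype ι] [DecidableEq ι] {u v : (ι → ℝ) → ℝ} {x : ι → ℝ}
    (h : u =ᶠ[𝓝 x] v) (i : ι) : pd i u x = pd i v x := by
  unfold pd; rw [h.fderiv_eq]

/-- The formulas for the tension and its derivatives hold only over `I`; locality is what allows
them to be differentiated again. -/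
lemma covAlong_congr {ι κ : Type*} [Fintype ι] [DecidableEq ι] [Fintype κ] [DecidableEq κ]
    {h : MetricField κ} {φ : (ι → ℝ) → (κ → ℝ)} {V W : (ι → ℝ) → (κ → ℝ)} {x : ι → ℝ}
    (hVW : V =ᶠ[𝓝 x] W) (i : ι) : covAlong h φ i V x = covAlong h φ i W x := by
  funext α
  have h1 : (fun y => V y α) =ᶠ[𝓝 x] fun y => W y α := hVW.mono fun y hy => by simp [hy]
  simp only [covAlong, pd_congr h1, hVW.eq_of_nhds]

/-- Christoffel symbols of a metric conformal to a constant one. -/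
lemma christoffel_conformal {ι : Type*} [Fintype ι] [DecidableEq ι] {G K : Matrix ι ι ℝ}
    (hKG : K * G = 1) (hG : G.IsSymm) {F : (ι → ℝ) → ℝ} {x : ι → ℝ}
    (hF : DifferentiableAt ℝ F x) (h0 : F x ≠ 0) (k i j : ι) :
    christoffel (fun y => (F y ^ 2)⁻¹ • G) k i j x =
      -(F x)⁻¹ * ((if k = j then pd i F x else 0) + (if k = i then pd j F x else 0)
        - G i j * ∑ l, K k l * pd l F x) := by
  have hinv : ((F x ^ 2)⁻¹ • G)⁻¹ = (F x ^ 2) • K := by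
    apply Matrix.inv_eq_left_inv
    rw [Matrix.smul_mul, Matrix.mul_smul, hKG, smul_smul, mul_inv_cancel₀ (pow_ne_zero 2 h0),
      one_smul]
  have hpd : ∀ l p q, pd l (fun y => ((F y ^ 2)⁻¹ • G) p q) x
      = -2 * (F x ^ 3)⁻¹ * pd l F x * G p q := by
    intro l p q
    have h1 : HasDerivAt (fun t : ℝ => (t ^ 2)⁻¹ * G p q) (-2 * (F x ^ 3)⁻¹ * G p q) (F x) := by
      have := ((hasDerivAt_pow 2 (F x)).fun_inv (pow_ne_zero 2 h0)).mul_const (G p q)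
      refine this.congr_deriv ?_
      field_simp
      norm_num
      ring
    have h2 := h1.comp_hasFDerivAt x hF.hasFDerivAt
    have h3 : (fun y => ((F y ^ 2)⁻¹ • G) p q) = (fun t : ℝ => (t ^ 2)⁻¹ * G p q) ∘ F := by
      funext y; simp
    unfold pd
    rw [h3, h2.fderiv]
    simp; ring
  have hKG' : ∀ p, ∑ l, K k l * G p l = if k = p then 1 else 0 := by
    intro p
    have := congrFun (congrFun hKG k) p
    rw [Matrix.mul_apply, Matrix.one_apply] at this
    rw [← this]
    exact Finset.sum_congr rfl fun l _ => by rw [hG.apply]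
  unfold christoffel
  rw [hinv]
  simp only [hpd]
  have h4 : ∀ l, (F x ^ 2 • K) k l * (-2 * (F x ^ 3)⁻¹ * pd i F x * G j l
        + -2 * (F x ^ 3)⁻¹ * pd j F x * G i l - -2 * (F x ^ 3)⁻¹ * pd l F x * G i j)
      = -2 * (F x)⁻¹ * (pd i F x * (K k l * G j l) + pd j F x * (K k l * G i l)
        - G i j * (K k l * pd l F x)) := by
    intro l
    simp only [Matrix.smul_apply, smul_eq_mul]
    field_simp
    ring
  rw [Finset.sum_congr rfl fun l _ => h4 l, ← Finset.mul_sum, Finset.sum_sub_distrib,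
    Finset.sum_add_distrib, ← Finset.mul_sum, ← Finset.mul_sum, ← Finset.mul_sum, hKG', hKG']
  split_ifs <;> ring

/-! ### Euclidean geometry of the hyperplanes and their induced metric. -/

section Hyperplane

variable {m : ℕ} (a : Fin m → ℝ) (c : ℝ) (f : ℝ → ℝ)

lemma hasFDerivAt_height (x : Fin m → ℝ) :
    HasFDerivAt (height a c) (∑ i, a i • ContinuousLinearMap.proj (R := ℝ) (φ := fun _ => ℝ) i)
      x := by
  unfold height
  refine HasFDerivAt.add_const c ?_
  refine HasFDerivAt.fun_sum fun i _ => ?_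
  exact (ContinuousLinearMap.proj (R := ℝ) (φ := fun _ : Fin m => ℝ) i).hasFDerivAt.const_mul (a i)

lemma pd_comp_height {u : ℝ → ℝ} {u' : ℝ} {x : Fin m → ℝ}
    (hu : HasDerivAt u u' (height a c x)) (i : Fin m) :
    pd i (fun y => u (height a c y)) x = a i * u' := by
  have h := hu.comp_hasFDerivAt x (hasFDerivAt_height a c x)
  unfold pd
  have h2 : (fun y => u (height a c y)) = u ∘ height a c := rfl
  rw [h2, h.fderiv]
  simp [Pi.single_apply]
  ring

lemma pd_comp_last {u : ℝ → ℝ} {u' : ℝ} {y : Fin (m + 1) → ℝ}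
    (hu : HasDerivAt u u' (y (Fin.last m))) (i : Fin (m + 1)) :
    pd i (fun y => u (y (Fin.last m))) y = if i = Fin.last m then u' else 0 := by
  have h := hu.comp_hasFDerivAt y
    (ContinuousLinearMap.proj (R := ℝ) (φ := fun _ : Fin (m + 1) => ℝ) (Fin.last m)).hasFDerivAt
  unfold pd
  have h2 : (fun y : Fin (m + 1) → ℝ => u (y (Fin.last m)))
    = u ∘ (ContinuousLinearMap.proj (R := ℝ) (φ := fun _ : Fin (m + 1) => ℝ) (Fin.last m)) := rfl
  rw [h2, h.fderiv]
  simp [Pi.single_apply, eq_comm]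

/-- The tangent vector `∂ᵢ + aᵢ ∂_z` of the hyperplanes. -/
noncomputable def tangentVec (i : Fin m) : Fin (m + 1) → ℝ :=
  Fin.snoc (α := fun _ => ℝ) (Pi.single i 1) (a i)

/-- The Euclidean normal `a₁ ∂₁ + ⋯ + a_m ∂_m - ∂_z` of the hyperplanes. -/
def normalVec : Fin (m + 1) → ℝ := Fin.snoc (α := fun _ => ℝ) a (-1)

@[simp] lemma tangentVec_last (i : Fin m) : tangentVec a i (Fin.last m) = a i := by
  simp [tangentVec]

@[simp] lemma tangentVec_castSucc (i j : Fin m) :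
    tangentVec a i j.castSucc = if j = i then 1 else 0 := by
  simp [tangentVec, Pi.single_apply]

@[simp] lemma normalVec_last : normalVec a (Fin.last m) = -1 := by simp [normalVec]

@[simp] lemma normalVec_castSucc (j : Fin m) : normalVec a j.castSucc = a j := by
  simp [normalVec]

lemma dmap_hyperplane (i : Fin m) (x : Fin m → ℝ) :
    dmap (hyperplane a c) i x = tangentVec a i := by
  funext α
  refine Fin.lastCases ?_ (fun j => ?_) α
  · have := pd_comp_height a c (hasDerivAt_id (height a c x)) i
    simpa [dmap, hyperplane] using this
  · have h : HasFDerivAt (fun y : Fin m → ℝ => y j)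
      (ContinuousLinearMap.proj (R := ℝ) (φ := fun _ : Fin m => ℝ) j) x :=
      (ContinuousLinearMap.proj (R := ℝ) (φ := fun _ : Fin m => ℝ) j).hasFDerivAt
    simp [dmap, hyperplane, pd, h.fderiv, Pi.single_apply]

lemma tangentVec_dotProduct (i j : Fin m) :
    tangentVec a i ⬝ᵥ tangentVec a j = (if i = j then 1 else 0) + a i * a j := by
  simp [dotProduct, Fin.sum_univ_castSucc, eq_comm]

lemma tangentVec_dotProduct_normalVec (i : Fin m) : tangentVec a i ⬝ᵥ normalVec a = 0 := by
  simp [dotProduct, Fin.sum_univ_castSucc]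

lemma normalVec_dotProduct : normalVec a ⬝ᵥ normalVec a = 1 + ∑ i, a i ^ 2 := by
  simp [dotProduct, Fin.sum_univ_castSucc, pow_two, add_comm]

lemma sum_sum_conformalMetric (y X Y : Fin (m + 1) → ℝ) :
    ∑ α, ∑ β, conformalMetric m f y α β * X α * Y β
      = (f (y (Fin.last m)) ^ 2)⁻¹ * (X ⬝ᵥ Y) := by
  simp [conformalMetric, Matrix.one_apply, dotProduct, Finset.mul_sum, mul_assoc]

@[simp] lemma hyperplane_last (x : Fin m → ℝ) :
    hyperplane a c x (Fin.last m) = height a c x := by simp [hyperplane]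

/-- The Euclidean metric induced on the hyperplanes. -/
def euclidGram : Matrix (Fin m) (Fin m) ℝ := 1 + Matrix.vecMulVec a a

/-- The inverse of `euclidGram a`. -/
noncomputable def euclidGramInv : Matrix (Fin m) (Fin m) ℝ :=
  1 - (1 + ∑ i, a i ^ 2)⁻¹ • Matrix.vecMulVec a a

lemma one_add_sum_sq_pos : 0 < 1 + ∑ i, a i ^ 2 := by positivity

lemma euclidGram_apply (i j : Fin m) :
    euclidGram a i j = (if i = j then 1 else 0) + a i * a j := by
  simp [euclidGram, Matrix.one_apply, Matrix.vecMulVec_apply]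

lemma euclidGram_isSymm : (euclidGram a).IsSymm := by
  ext i j
  simp [euclidGram_apply, eq_comm, mul_comm]

/-- This is the Sherman–Morrison formula for a rank one perturbation of the identity. -/
lemma euclidGramInv_mul : euclidGramInv a * euclidGram a = 1 := by
  have h := (one_add_sum_sq_pos a).ne'
  have h2 : Matrix.vecMulVec a a * Matrix.vecMulVec a a
      = (∑ i, a i ^ 2) • Matrix.vecMulVec a a := by
    rw [Matrix.vecMulVec_mul_vecMulVec]
    ext i j
    simp [Matrix.vecMulVec_apply, dotProduct, pow_two]
    ring
  have h3 : (1 + ∑ i, a i ^ 2)⁻¹ + (1 + ∑ i, a i ^ 2)⁻¹ * ∑ i, a i ^ 2 = 1 := by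
    field_simp
  rw [euclidGramInv, euclidGram, sub_mul, mul_add, one_mul, Matrix.smul_mul, mul_add, mul_one,
    h2, smul_add, smul_smul, ← add_smul, h3, one_smul]
  simp

lemma pullbackMetric_hyperplane :
    pullbackMetric (conformalMetric m f) (hyperplane a c)
      = fun x => (f (height a c x) ^ 2)⁻¹ • euclidGram a := by
  funext x
  ext i j
  simp only [pullbackMetric, Matrix.of_apply, dmap_hyperplane, sum_sum_conformalMetric,
    tangentVec_dotProduct, hyperplane_last, Matrix.smul_apply, euclidGram_apply, smul_eq_mul]

/-- Traces with respect to `euclidGramInv a`. -/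
lemma sum_euclidGramInv_gram :
    ∑ i, ∑ j, euclidGramInv a i j * euclidGram a i j = m := by
  have : ∀ i, ∑ j, euclidGramInv a i j * euclidGram a i j = 1 := by
    intro i
    have := congrFun (congrFun (euclidGramInv_mul a) i) i
    rw [Matrix.mul_apply, Matrix.one_apply_eq] at this
    rw [← this]
    exact Finset.sum_congr rfl fun j _ => by rw [(euclidGram_isSymm a).apply]
  simp [this]

lemma sum_euclidGramInv_mul (k : Fin m) :
    ∑ l, euclidGramInv a k l * a l = (1 + ∑ i, a i ^ 2)⁻¹ * a k := by
  have h := (one_add_sum_sq_pos a).ne'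
  have : ∀ l, euclidGramInv a k l * a l
      = (if k = l then a l else 0) - (1 + ∑ i, a i ^ 2)⁻¹ * a k * a l ^ 2 := by
    intro l
    simp [euclidGramInv, Matrix.one_apply, Matrix.vecMulVec_apply, sub_mul]
    ring
  simp only [this, Finset.sum_sub_distrib, ← Finset.mul_sum, Finset.sum_ite_eq, Finset.mem_univ,
    if_true]
  field_simp
  ring

lemma euclidGramInv_symm (i j : Fin m) : euclidGramInv a i j = euclidGramInv a j i := by
  simp [euclidGramInv, Matrix.one_apply, Matrix.vecMulVec_apply, eq_comm, mul_comm]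

lemma inv_conformal_euclidGram {t : ℝ} (ht : t ≠ 0) :
    ((t ^ 2)⁻¹ • euclidGram a)⁻¹ = t ^ 2 • euclidGramInv a := by
  apply Matrix.inv_eq_left_inv
  rw [Matrix.smul_mul, Matrix.mul_smul, euclidGramInv_mul, smul_smul,
    mul_inv_cancel₀ (pow_ne_zero 2 ht), one_smul]

end Hyperplane

/-! ### Connection and curvature of the ambient metric. -/

section Ambient

variable {m : ℕ}

/-- The Christoffel symbols of `exp (2 z) (dx₁² + ⋯ + dx_m² + dz²)`. -/
noncomputable def conformalSymbol (l j k : Fin (m + 1)) : ℝ :=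
  (if l = k then 1 else 0) * (if j = Fin.last m then 1 else 0)
    + (if l = j then 1 else 0) * (if k = Fin.last m then 1 else 0)
    - (if j = k then 1 else 0) * (if l = Fin.last m then 1 else 0)

/-- The bilinear map with coefficients `conformalSymbol`. -/
noncomputable def conformalBilin (X Y : Fin (m + 1) → ℝ) (l : Fin (m + 1)) : ℝ :=
  X (Fin.last m) * Y l + X l * Y (Fin.last m) - (X ⬝ᵥ Y) * if l = Fin.last m then 1 else 0

lemma christoffel_conformalMetric {f : ℝ → ℝ} {y : Fin (m + 1) → ℝ}
    (hf : DifferentiableAt ℝ f (y (Fin.last m))) (h0 : f (y (Fin.last m)) ≠ 0)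
    (l j k : Fin (m + 1)) :
    christoffel (conformalMetric m f) l j k y
      = -(deriv f (y (Fin.last m)) / f (y (Fin.last m))) * conformalSymbol l j k := by
  have hF : DifferentiableAt ℝ (fun y : Fin (m + 1) → ℝ => f (y (Fin.last m))) y :=
    hf.comp y (differentiableAt_apply (Fin.last m) y)
  have h := christoffel_conformal (one_mul (1 : Matrix (Fin (m + 1)) (Fin (m + 1)) ℝ))
    Matrix.isSymm_one hF h0 l j k
  simp only [pd_comp_last hf.hasDerivAt] at h
  unfold conformalMetric
  rw [h]
  simp only [Matrix.one_apply, conformalSymbol, ite_mul, one_mul, zero_mul, Finset.sum_ite_eq,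
    Finset.mem_univ, if_true]
  split_ifs <;> ring

lemma sum_sum_conformalSymbol (X Y : Fin (m + 1) → ℝ) (l : Fin (m + 1)) :
    ∑ j, ∑ k, conformalSymbol l j k * X j * Y k = conformalBilin X Y l := by
  simp only [conformalSymbol, conformalBilin, add_mul, sub_mul, ite_mul, one_mul, zero_mul,
    Finset.sum_add_distrib, Finset.sum_sub_distrib, Finset.sum_ite_eq, Finset.sum_ite_eq',
    Finset.mem_univ, if_true, dotProduct]
  split_ifs <;> simp

/-- This is the contraction occurring in the terms of the curvature that are quadratic in the
Christoffel symbols. -/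
lemma sum_conformalSymbol_mul (D : Fin (m + 1) → ℝ) (l i : Fin (m + 1)) :
    ∑ p, conformalSymbol l i p * D p = (if i = Fin.last m then 1 else 0) * D l
      + (if l = i then 1 else 0) * D (Fin.last m) - (if l = Fin.last m then 1 else 0) * D i := by
  simp only [conformalSymbol, add_mul, sub_mul, ite_mul, one_mul, zero_mul,
    Finset.sum_add_distrib, Finset.sum_sub_distrib, Finset.sum_ite_eq, Finset.mem_univ, if_true]
  split_ifs <;> simp

/-- The Christoffel symbols are a function of `z` times constants: derivatives contribute `p'` and
only in the last direction, while products contribute `(f'/f)²`. -/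
lemma curvature_conformalMetric {f : ℝ → ℝ} {y : Fin (m + 1) → ℝ} {p' : ℝ}
    (hf : ∀ᶠ z in 𝓝 (y (Fin.last m)), DifferentiableAt ℝ f z ∧ f z ≠ 0)
    (hp : HasDerivAt (fun z => -(deriv f z / f z)) p' (y (Fin.last m)))
    (l i j k : Fin (m + 1)) :
    curvature (conformalMetric m f) l i j k y
      = p' * ((if i = Fin.last m then 1 else 0) * conformalSymbol l j k
            - (if j = Fin.last m then 1 else 0) * conformalSymbol l i k)
        + (deriv f (y (Fin.last m)) / f (y (Fin.last m))) ^ 2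
          * (((if i = Fin.last m then 1 else 0) * conformalSymbol l j k
              + (if l = i then 1 else 0) * conformalSymbol (Fin.last m) j k
              - (if l = Fin.last m then 1 else 0) * conformalSymbol i j k)
            - ((if j = Fin.last m then 1 else 0) * conformalSymbol l i k
              + (if l = j then 1 else 0) * conformalSymbol (Fin.last m) i k
              - (if l = Fin.last m then 1 else 0) * conformalSymbol j i k)) := by
  have hev : ∀ᶠ w in 𝓝 y, DifferentiableAt ℝ f (w (Fin.last m)) ∧ f (w (Fin.last m)) ≠ 0 :=
    (continuous_apply (Fin.last m)).continuousAt.eventually hf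
  have hpd : ∀ q l j k, pd q (christoffel (conformalMetric m f) l j k) y
      = (if q = Fin.last m then 1 else 0) * p' * conformalSymbol l j k := by
    intro q l j k
    rw [pd_congr (hev.mono fun w hw => christoffel_conformalMetric hw.1 hw.2 l j k),
      pd_comp_last (hp.mul_const (conformalSymbol l j k))]
    split_ifs <;> ring
  have hy := hf.self_of_nhds
  rw [← sum_conformalSymbol_mul (fun p => conformalSymbol p j k),
    ← sum_conformalSymbol_mul (fun p => conformalSymbol p i k), ← Finset.sum_sub_distrib,
    Finset.mul_sum]
  simp only [curvature, hpd, christoffel_conformalMetric hy.1 hy.2]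
  congr 1
  · ring
  · exact Finset.sum_congr rfl fun p _ => by ring

lemma curvatureOp_conformalMetric {f : ℝ → ℝ} {y : Fin (m + 1) → ℝ} {p' : ℝ}
    (hf : ∀ᶠ z in 𝓝 (y (Fin.last m)), DifferentiableAt ℝ f z ∧ f z ≠ 0)
    (hp : HasDerivAt (fun z => -(deriv f z / f z)) p' (y (Fin.last m)))
    (X Y Z : Fin (m + 1) → ℝ) (l : Fin (m + 1)) :
    curvatureOp (conformalMetric m f) y X Y Z l
      = ((deriv f (y (Fin.last m)) / f (y (Fin.last m))) ^ 2 - p')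
          * (X l * Y (Fin.last m) * Z (Fin.last m) - Y l * X (Fin.last m) * Z (Fin.last m)
            + (X (Fin.last m) * (Y ⬝ᵥ Z) - Y (Fin.last m) * (X ⬝ᵥ Z))
              * if l = Fin.last m then 1 else 0)
        - (deriv f (y (Fin.last m)) / f (y (Fin.last m))) ^ 2
          * ((Y ⬝ᵥ Z) * X l - (X ⬝ᵥ Z) * Y l) := by
  set q := (deriv f (y (Fin.last m)) / f (y (Fin.last m))) ^ 2 with hq
  have h1 : ∀ s : Fin (m + 1) → ℝ, ∀ D : Fin (m + 1) → Fin (m + 1) → Fin (m + 1) → ℝ,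
      ∀ U V : Fin (m + 1) → ℝ,
      ∑ i, ∑ j, ∑ k, (s i * D i j k) * U i * V j * Z k
        = ∑ i, s i * U i * ∑ j, ∑ k, D i j k * V j * Z k := by
    intro s D U V
    simp only [Finset.mul_sum]
    exact Finset.sum_congr rfl fun i _ => Finset.sum_congr rfl fun j _ =>
      Finset.sum_congr rfl fun k _ => by ring
  -- The curvature is antisymmetric in its first two arguments; this sums one half, and the other
  -- follows by exchanging `X` and `Y`.
  have h2 : ∀ U V : Fin (m + 1) → ℝ, ∑ i, ∑ j, ∑ k,
      ((p' + q) * ((if i = Fin.last m then 1 else 0) * conformalSymbol l j k) * U i * V j * Z k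
        + q * ((if l = i then 1 else 0) * conformalSymbol (Fin.last m) j k * U i * V j * Z k)
        - q * ((if l = Fin.last m then 1 else 0) * conformalSymbol i j k * U i * V j * Z k))
      = (p' + q) * (U (Fin.last m) * conformalBilin V Z l)
        + q * (U l * conformalBilin V Z (Fin.last m))
        - q * ((if l = Fin.last m then 1 else 0) * ∑ i, U i * conformalBilin V Z i) := by
    intro U V
    simp only [mul_assoc (p' + q), Finset.sum_add_distrib, Finset.sum_sub_distrib,
      ← Finset.mul_sum]
    rw [h1 (fun i => if i = Fin.last m then 1 else 0) (fun _ j k => conformalSymbol l j k),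
      h1 (fun i => if l = i then 1 else 0) (fun _ j k => conformalSymbol (Fin.last m) j k),
      h1 (fun _ => if l = Fin.last m then 1 else 0) (fun i j k => conformalSymbol i j k)]
    simp only [sum_sum_conformalSymbol, ite_mul, one_mul, zero_mul, Finset.sum_ite_eq,
      Finset.sum_ite_eq', Finset.mem_univ, if_true]
    split_ifs <;> simp
  have h3 : curvatureOp (conformalMetric m f) y X Y Z l
      = ((p' + q) * (X (Fin.last m) * conformalBilin Y Z l)
        + q * (X l * conformalBilin Y Z (Fin.last m))
        - q * ((if l = Fin.last m then 1 else 0) * ∑ i, X i * conformalBilin Y Z i))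
       - ((p' + q) * (Y (Fin.last m) * conformalBilin X Z l)
        + q * (Y l * conformalBilin X Z (Fin.last m))
        - q * ((if l = Fin.last m then 1 else 0) * ∑ i, Y i * conformalBilin X Z i)) := by
    rw [← h2 X Y, ← h2 Y X]
    conv_rhs => enter [2]; rw [Finset.sum_comm]
    simp only [← Finset.sum_sub_distrib, curvatureOp, curvature_conformalMetric hf hp, ← hq]
    exact Finset.sum_congr rfl fun i _ => Finset.sum_congr rfl fun j _ =>
      Finset.sum_congr rfl fun k _ => by ring
  have h4 : ∀ U V : Fin (m + 1) → ℝ, ∑ i, U i * conformalBilin V Z i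
      = V (Fin.last m) * (U ⬝ᵥ Z) + Z (Fin.last m) * (U ⬝ᵥ V) - (V ⬝ᵥ Z) * U (Fin.last m) := by
    intro U V
    simp only [conformalBilin, mul_sub, mul_add, Finset.sum_sub_distrib, Finset.sum_add_distrib,
      dotProduct, Finset.mul_sum, Finset.sum_mul]
    simp
    congr 1
    · congr 1 <;> exact Finset.sum_congr rfl fun i _ => by ring
    · exact Finset.sum_congr rfl fun i _ => by ring
  rw [h3, h4, h4, dotProduct_comm Y X]
  simp only [conformalBilin, if_true]
  ring

end Ambient

/-! ### Higher derivatives of `f` on the open set `I`. -/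

section SmoothFunction

variable {I : Set ℝ} {f : ℝ → ℝ}

lemma hasDerivAt_iteratedDeriv (hIo : IsOpen I) (hf : ContDiffOn ℝ ∞ f I) {z : ℝ} (hz : z ∈ I)
    (n : ℕ) : HasDerivAt (iteratedDeriv n f) (iteratedDeriv (n + 1) f z) z := by
  have h : ContDiffAt ℝ ∞ f z := hf.contDiffAt (hIo.mem_nhds hz)
  have hd : DifferentiableAt ℝ (iteratedDeriv n f) z := by
    have h1 : ContDiffAt ℝ 1 (iteratedFDeriv ℝ n f) z :=
      h.iteratedFDeriv_right (m := 1) (by exact_mod_cast le_top)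
    rw [iteratedDeriv_eq_equiv_comp]
    exact (LinearIsometryEquiv.differentiableAt _).comp z (h1.differentiableAt one_ne_zero)
  rw [iteratedDeriv_succ]
  exact hd.hasDerivAt

lemma hasDerivAt_deriv_zero (hIo : IsOpen I) (hf : ContDiffOn ℝ ∞ f I) {z : ℝ} (hz : z ∈ I) :
    HasDerivAt f (deriv f z) z := by
  simpa [iteratedDeriv_zero, iteratedDeriv_one] using hasDerivAt_iteratedDeriv hIo hf hz 0

lemma hasDerivAt_deriv_one (hIo : IsOpen I) (hf : ContDiffOn ℝ ∞ f I) {z : ℝ} (hz : z ∈ I) :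
    HasDerivAt (deriv f) (iteratedDeriv 2 f z) z := by
  simpa [iteratedDeriv_one] using hasDerivAt_iteratedDeriv hIo hf hz 1

end SmoothFunction

/-! ### Traces and contractions with tangent and normal vectors. -/

section Trace

variable {m : ℕ} (a : Fin m → ℝ)

/-- Every trace needed below has this shape, with `e i` a component of `tangentVec a i`. It reduces
to two facts: the inverse Gram matrix maps `a` to `(1 + S)⁻¹ a`, and its trace against the Gram
matrix is `m`. -/
lemma sum_sum_euclidGramInv (e : Fin m → ℝ) (u v w t : ℝ) :
    ∑ i, ∑ j, euclidGramInv a i j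
        * (a i * a j * u + a j * e i * v + a i * e j * w + euclidGram a i j * t)
      = (1 + ∑ i, a i ^ 2)⁻¹ * ((∑ i, a i ^ 2) * u + (∑ i, a i * e i) * (v + w)) + m * t := by
  have h1 : ∀ b d : Fin m → ℝ, ∑ i, ∑ j, euclidGramInv a i j * (a j * (b i * d i))
      = (1 + ∑ i, a i ^ 2)⁻¹ * ∑ i, a i * (b i * d i) := by
    intro b d
    have : ∀ i, ∑ j, euclidGramInv a i j * (a j * (b i * d i))
        = (1 + ∑ i, a i ^ 2)⁻¹ * (a i * (b i * d i)) := by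
      intro i
      rw [← mul_assoc, ← sum_euclidGramInv_mul, Finset.sum_mul]
      exact Finset.sum_congr rfl fun j _ => by ring
    simp only [this, Finset.mul_sum]
  have h2 : ∀ b d : Fin m → ℝ, ∑ i, ∑ j, euclidGramInv a i j * (a i * (b j * d j))
      = (1 + ∑ i, a i ^ 2)⁻¹ * ∑ i, a i * (b i * d i) := by
    intro b d
    rw [Finset.sum_comm, ← h1]
    exact Finset.sum_congr rfl fun i _ => Finset.sum_congr rfl fun j _ => by
      rw [euclidGramInv_symm]
  have h3 : ∀ i j, euclidGramInv a i j
        * (a i * a j * u + a j * e i * v + a i * e j * w + euclidGram a i j * t)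
      = euclidGramInv a i j * (a j * (a i * u)) + euclidGramInv a i j * (a j * (e i * v))
        + euclidGramInv a i j * (a i * (e j * w))
        + euclidGramInv a i j * euclidGram a i j * t := fun i j => by ring
  simp only [h3, Finset.sum_add_distrib]
  rw [h1 a fun _ => u, h1 e fun _ => v, h2 e fun _ => w]
  simp only [← Finset.sum_mul, sum_euclidGramInv_gram, ← mul_assoc]
  simp only [← pow_two]
  ring

/-- The tangential vector `∑ a i e i` equals `ν + (1 + S) ∂_z`, so stray `∂_z` terms can be split
into tangential and normal parts. -/
lemma sum_mul_tangentVec (α : Fin (m + 1)) :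
    ∑ i, a i * tangentVec a i α
      = normalVec a α + if α = Fin.last m then 1 + ∑ i, a i ^ 2 else 0 := by
  refine Fin.lastCases ?_ (fun j => ?_) α
  · simp [pow_two]
  · simp [Fin.castSucc_ne_last]

lemma conformalBilin_tangentVec_normalVec (i : Fin m) (t : ℝ) (α : Fin (m + 1)) :
    conformalBilin (tangentVec a i) (t • normalVec a) α
      = t * (a i * normalVec a α - tangentVec a i α) := by
  simp only [conformalBilin, dotProduct_smul, tangentVec_dotProduct_normalVec, tangentVec_last,
    Pi.smul_apply, normalVec_last, smul_eq_mul]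
  ring

lemma conformalBilin_tangentVec (i j : Fin m) (α : Fin (m + 1)) :
    conformalBilin (tangentVec a i) (tangentVec a j) α
      = a i * tangentVec a j α + a j * tangentVec a i α
        - euclidGram a i j * if α = Fin.last m then 1 else 0 := by
  simp only [conformalBilin, tangentVec_dotProduct, tangentVec_last, euclidGram_apply]
  ring

lemma conformalBilin_add_smul {m : ℕ} (X Y Z : Fin (m + 1) → ℝ) (s t : ℝ) (l : Fin (m + 1)) :
    conformalBilin X (s • Y + t • Z) l = s * conformalBilin X Y l + t * conformalBilin X Z l := by
  simp only [conformalBilin, dotProduct_add, dotProduct_smul, Pi.add_apply, Pi.smul_apply,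
    smul_eq_mul]
  ring

end Trace

/-! ### Second fundamental form and tension field. -/

section Hyperplane

variable {m : ℕ} {a : Fin m → ℝ} {c : ℝ} {f : ℝ → ℝ} {x : Fin m → ℝ}

lemma inv_pullbackMetric_hyperplane (h0 : f (height a c x) ≠ 0) (i j : Fin m) :
    (pullbackMetric (conformalMetric m f) (hyperplane a c) x)⁻¹ i j
      = f (height a c x) ^ 2 * euclidGramInv a i j := by
  rw [pullbackMetric_hyperplane]
  simp only [inv_conformal_euclidGram a h0, Matrix.smul_apply, smul_eq_mul]

lemma sum_christoffel_hyperplane (hf : DifferentiableAt ℝ f (height a c x))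
    (h0 : f (height a c x) ≠ 0) (i j : Fin m) (W : Fin m → ℝ) :
    ∑ k, christoffel (pullbackMetric (conformalMetric m f) (hyperplane a c)) k i j x * W k
      = -(deriv f (height a c x) / f (height a c x))
        * (a i * W j + a j * W i
          - euclidGram a i j * ((1 + ∑ i, a i ^ 2)⁻¹ * ∑ k, a k * W k)) := by
  have hF : DifferentiableAt ℝ (fun y => f (height a c y)) x :=
    hf.comp x (hasFDerivAt_height a c x).differentiableAt
  have h : ∀ k, christoffel (pullbackMetric (conformalMetric m f) (hyperplane a c)) k i j x
      = -(deriv f (height a c x) / f (height a c x))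
        * ((if k = j then a i else 0) + (if k = i then a j else 0)
          - euclidGram a i j * ((1 + ∑ i, a i ^ 2)⁻¹ * a k)) := by
    intro k
    rw [pullbackMetric_hyperplane, christoffel_conformal (euclidGramInv_mul a)
      (euclidGram_isSymm a) hF h0 k i j]
    simp only [pd_comp_height a c hf.hasDerivAt, ← mul_assoc, ← Finset.sum_mul,
      sum_euclidGramInv_mul]
    split_ifs <;> ring
  simp only [h, mul_assoc]
  rw [← Finset.mul_sum]
  simp only [sub_mul, add_mul, ite_mul, zero_mul, Finset.sum_sub_distrib, Finset.sum_add_distrib,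
    Finset.sum_ite_eq', Finset.mem_univ, if_true, mul_assoc, ← Finset.mul_sum]

/-- All fields to be differentiated depend on the height only, so their derivative along `∂ᵢ` is `a
i` times an ordinary derivative in `z`. -/
lemma covAlong_hyperplane (hf : DifferentiableAt ℝ f (height a c x))
    (h0 : f (height a c x) ≠ 0) {W : ℝ → Fin (m + 1) → ℝ} {W' : Fin (m + 1) → ℝ}
    (hW : HasDerivAt W W' (height a c x)) (i : Fin m) (α : Fin (m + 1)) :
    covAlong (conformalMetric m f) (hyperplane a c) i (fun y => W (height a c y)) x α
      = a i * W' α - deriv f (height a c x) / f (height a c x)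
        * conformalBilin (tangentVec a i) (W (height a c x)) α := by
  have hl := hyperplane_last a c x
  have h1 : DifferentiableAt ℝ f (hyperplane a c x (Fin.last m)) := by rwa [hl]
  have h2 : f (hyperplane a c x (Fin.last m)) ≠ 0 := by rwa [hl]
  simp only [covAlong, pd_comp_height a c (hasDerivAt_pi.1 hW α), dmap_hyperplane,
    christoffel_conformalMetric h1 h2, hl, ← sum_sum_conformalSymbol, Finset.mul_sum]
  rw [sub_eq_add_neg, ← Finset.sum_neg_distrib]
  congr 1
  refine Finset.sum_congr rfl fun j _ => ?_
  rw [← Finset.sum_neg_distrib]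
  exact Finset.sum_congr rfl fun k _ => by ring

/-- The symmetric terms `a i e j + a j e i` of the two connections cancel, and so do the `∂_z`
terms, because `(1 + S)⁻¹ (1 + S) = 1`. Only the normal term of the induced connection survives. -/
lemma secondFundForm_hyperplane (hf : DifferentiableAt ℝ f (height a c x))
    (h0 : f (height a c x) ≠ 0) (i j : Fin m) :
    secondFundForm (pullbackMetric (conformalMetric m f) (hyperplane a c)) (conformalMetric m f)
        (hyperplane a c) i j x
      = (-(deriv f (height a c x) / f (height a c x)) * (1 + ∑ i, a i ^ 2)⁻¹ * euclidGram a i j)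
        • normalVec a := by
  have hd : dmap (hyperplane a c) j
      = fun y => (fun _ : ℝ => tangentVec a j) (height a c y) := by
    funext y; exact dmap_hyperplane a c j y
  have hS := (one_add_sum_sq_pos a).ne'
  funext α
  simp only [secondFundForm, Pi.sub_apply, Finset.sum_apply, Pi.smul_apply, smul_eq_mul]
  rw [sum_christoffel_hyperplane hf h0 i j fun k => dmap (hyperplane a c) k x α, hd,
    covAlong_hyperplane hf h0 (hasDerivAt_const _ _)]
  simp only [dmap_hyperplane, sum_mul_tangentVec, conformalBilin_tangentVec, Pi.zero_apply]
  split_ifs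
  · field_simp
    ring
  · ring

lemma tension_hyperplane (hf : DifferentiableAt ℝ f (height a c x))
    (h0 : f (height a c x) ≠ 0) :
    tension (pullbackMetric (conformalMetric m f) (hyperplane a c)) (conformalMetric m f)
        (hyperplane a c) x
      = (-(m * (1 + ∑ i, a i ^ 2)⁻¹) * (f (height a c x) * deriv f (height a c x)))
        • normalVec a := by
  simp only [tension, secondFundForm_hyperplane hf h0, inv_pullbackMetric_hyperplane h0,
    smul_smul, ← Finset.sum_smul]
  congr 1
  have : ∀ i j, f (height a c x) ^ 2 * euclidGramInv a i j
      * (-(deriv f (height a c x) / f (height a c x)) * (1 + ∑ i, a i ^ 2)⁻¹ * euclidGram a i j)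
      = -(f (height a c x) * deriv f (height a c x) * (1 + ∑ i, a i ^ 2)⁻¹)
        * (euclidGramInv a i j * euclidGram a i j) := by
    intro i j
    field_simp
  simp only [this, ← Finset.mul_sum, sum_euclidGramInv_gram]
  ring

end Hyperplane

/-! ### The bitension field and its vanishing. -/

section Bitension

variable {m : ℕ} {a : Fin m → ℝ} {c : ℝ} {I : Set ℝ} {f : ℝ → ℝ} {x : Fin m → ℝ}

lemma eventually_height_mem (hIo : IsOpen I) (hx : x ∈ hyperplaneDomain a c I) :
    ∀ᶠ y in 𝓝 x, y ∈ hyperplaneDomain a c I :=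
  (hasFDerivAt_height a c x).continuousAt.eventually (hIo.mem_nhds hx)

/-- Differentiating `f f'` gives `f'² + f f''`; the normal `f'²` term is cancelled by the
connection, which leaves `f'²` in the direction `e i` instead. -/
lemma covAlong_tension_hyperplane (hIo : IsOpen I) (hf : ContDiffOn ℝ ∞ f I)
    (hpos : ∀ z ∈ I, 0 < f z) (hx : x ∈ hyperplaneDomain a c I) (i : Fin m) :
    covAlong (conformalMetric m f) (hyperplane a c) i
        (tension (pullbackMetric (conformalMetric m f) (hyperplane a c)) (conformalMetric m f)
          (hyperplane a c)) x
      = (a i * (-(m * (1 + ∑ i, a i ^ 2)⁻¹)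
          * (f (height a c x) * iteratedDeriv 2 f (height a c x)))) • normalVec a
        + (-(m * (1 + ∑ i, a i ^ 2)⁻¹) * deriv f (height a c x) ^ 2) • tangentVec a i := by
  have hf' := fun z (hz : z ∈ I) => (hasDerivAt_deriv_zero hIo hf hz)
  have hev : tension (pullbackMetric (conformalMetric m f) (hyperplane a c)) (conformalMetric m f)
      (hyperplane a c) =ᶠ[𝓝 x] fun y => (fun z => (-(m * (1 + ∑ i, a i ^ 2)⁻¹) * (f z * deriv f z))
        • normalVec a) (height a c y) :=
    (eventually_height_mem hIo hx).mono fun y hy =>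
      tension_hyperplane (hf' _ hy).differentiableAt (hpos _ hy).ne'
  have hW : HasDerivAt (fun z => (-(m * (1 + ∑ i, a i ^ 2)⁻¹) * (f z * deriv f z)) • normalVec a)
      _ (height a c x) :=
    (((hf' _ hx).mul (hasDerivAt_deriv_one hIo hf hx)).const_mul
      (-(m * (1 + ∑ i, a i ^ 2)⁻¹))).smul_const (normalVec a)
  have h0 := (hpos _ hx).ne'
  rw [covAlong_congr hev]
  funext α
  rw [covAlong_hyperplane (hf' _ hx).differentiableAt h0 hW,
    conformalBilin_tangentVec_normalVec]
  simp only [Pi.add_apply, Pi.smul_apply, smul_eq_mul]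
  field_simp
  ring

lemma roughLaplacian_tension_hyperplane (hIo : IsOpen I) (hf : ContDiffOn ℝ ∞ f I)
    (hpos : ∀ z ∈ I, 0 < f z) (hx : x ∈ hyperplaneDomain a c I) :
    roughLaplacian (pullbackMetric (conformalMetric m f) (hyperplane a c)) (conformalMetric m f)
        (hyperplane a c) (tension (pullbackMetric (conformalMetric m f) (hyperplane a c))
          (conformalMetric m f) (hyperplane a c)) x
      = (-(m * (1 + ∑ i, a i ^ 2)⁻¹ ^ 2 * f (height a c x)))
        • (((∑ i, a i ^ 2) * f (height a c x) ^ 2 * iteratedDeriv 3 f (height a c x)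
            + (2 - m) * (∑ i, a i ^ 2) * f (height a c x) * deriv f (height a c x)
              * iteratedDeriv 2 f (height a c x)
            - m * deriv f (height a c x) ^ 3) • normalVec a
          + (3 * f (height a c x) * deriv f (height a c x) * iteratedDeriv 2 f (height a c x))
            • ∑ i, a i • tangentVec a i) := by
  set S := ∑ i, a i ^ 2 with hS
  set κ := (1 + S)⁻¹ with hκ
  have hSpos : 1 + S ≠ 0 := (one_add_sum_sq_pos a).ne'
  have hf0 := hasDerivAt_deriv_zero hIo hf hx
  have hf1 := hasDerivAt_deriv_one hIo hf hx
  have hf2 := hasDerivAt_iteratedDeriv hIo hf hx 2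
  have h0 := (hpos _ hx).ne'
  set z := height a c x with hz
  have hcov : ∀ j, covAlong (conformalMetric m f) (hyperplane a c) j
        (tension (pullbackMetric (conformalMetric m f) (hyperplane a c)) (conformalMetric m f)
          (hyperplane a c)) =ᶠ[𝓝 x] fun y => (fun t =>
        (a j * (-(m * κ) * (f t * iteratedDeriv 2 f t))) • normalVec a
        + (-(m * κ) * deriv f t ^ 2) • tangentVec a j) (height a c y) := fun j =>
    (eventually_height_mem hIo hx).mono fun y hy => covAlong_tension_hyperplane hIo hf hpos hy j
  have hW : ∀ j, HasDerivAt (fun t =>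
        (a j * (-(m * κ) * (f t * iteratedDeriv 2 f t))) • normalVec a
        + (-(m * κ) * deriv f t ^ 2) • tangentVec a j) _ z := fun j =>
    ((((hf0.mul hf2).const_mul (-(m * κ))).const_mul (a j)).smul_const (normalVec a)).add
      (((hf1.fun_pow 2).const_mul (-(m * κ))).smul_const (tangentVec a j))
  funext α
  -- The second covariant derivative is put in the form to which `sum_sum_euclidGramInv` applies.
  have hterm : ∀ i j, covAlong (conformalMetric m f) (hyperplane a c) i
        (covAlong (conformalMetric m f) (hyperplane a c) j
          (tension (pullbackMetric (conformalMetric m f) (hyperplane a c)) (conformalMetric m f)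
            (hyperplane a c))) x α
        - ∑ k, christoffel (pullbackMetric (conformalMetric m f) (hyperplane a c)) k i j x
          * covAlong (conformalMetric m f) (hyperplane a c) k
          (tension (pullbackMetric (conformalMetric m f) (hyperplane a c)) (conformalMetric m f)
            (hyperplane a c)) x α
      = a i * a j * (-(m * κ) * (2 * deriv f z * iteratedDeriv 2 f z + f z * iteratedDeriv 3 f z)
          * normalVec a α)
        + a j * tangentVec a i α * (-(m * κ) * (deriv f z * iteratedDeriv 2 f z))
        + a i * tangentVec a j α * (-(m * κ) * (2 * deriv f z * iteratedDeriv 2 f z))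
        + euclidGram a i j * (m * κ ^ 2 * (S * (deriv f z * iteratedDeriv 2 f z)
          + deriv f z ^ 3 / f z) * normalVec a α) := by
    intro i j
    rw [sum_christoffel_hyperplane hf0.differentiableAt h0 i j fun k =>
      covAlong (conformalMetric m f) (hyperplane a c) k
          (tension (pullbackMetric (conformalMetric m f) (hyperplane a c)) (conformalMetric m f)
            (hyperplane a c)) x α,
      covAlong_congr (hcov j), covAlong_hyperplane hf0.differentiableAt h0 (hW j)]
    simp only [covAlong_tension_hyperplane hIo hf hpos hx, conformalBilin_add_smul,
      conformalBilin_tangentVec, Pi.add_apply, Pi.smul_apply, smul_eq_mul, ← hz, ← hS, ← hκ]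
    have hb := conformalBilin_tangentVec_normalVec a i 1 α
    rw [one_smul, one_mul] at hb
    have hsum : ∑ k, a k * (a k * (-(m * κ) * (f z * iteratedDeriv 2 f z)) * normalVec a α
          + -(m * κ) * deriv f z ^ 2 * tangentVec a k α)
        = S * (-(m * κ) * (f z * iteratedDeriv 2 f z)) * normalVec a α
          + -(m * κ) * deriv f z ^ 2
            * (normalVec a α + if α = Fin.last m then 1 + S else 0) := by
      rw [hS, ← sum_mul_tangentVec, Finset.mul_sum, Finset.sum_mul, Finset.sum_mul,
        ← Finset.sum_add_distrib]
      exact Finset.sum_congr rfl fun k _ => by ring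
    rw [hsum, hb]
    have hκ1 : κ * (1 + S) = 1 := inv_mul_cancel₀ hSpos
    have hsplit : κ * (S * (-(m * κ) * (f z * iteratedDeriv 2 f z)) * normalVec a α
          + -(m * κ) * deriv f z ^ 2
            * (normalVec a α + if α = Fin.last m then 1 + S else 0))
        = -(m * κ ^ 2) * (S * (f z * iteratedDeriv 2 f z) + deriv f z ^ 2) * normalVec a α
          - m * κ * deriv f z ^ 2 * if α = Fin.last m then 1 else 0 := by
      split_ifs
      · linear_combination (-(m * κ) * deriv f z ^ 2) * hκ1
      · ring
    rw [hsplit]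
    clear_value κ S z
    field_simp
    ring
  simp only [roughLaplacian, Finset.sum_apply, Pi.smul_apply, Pi.sub_apply, smul_eq_mul, hterm,
    inv_pullbackMetric_hyperplane h0, mul_assoc (f _ ^ 2), ← Finset.mul_sum,
    sum_sum_euclidGramInv, Pi.add_apply, ← hz, ← hS, ← hκ]
  clear_value κ S z
  field_simp
  ring

lemma hasDerivAt_neg_logDeriv (hIo : IsOpen I) (hf : ContDiffOn ℝ ∞ f I)
    (hpos : ∀ z ∈ I, 0 < f z) {z : ℝ} (hz : z ∈ I) :
    HasDerivAt (fun t => -(deriv f t / f t))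
      ((deriv f z / f z) ^ 2 - iteratedDeriv 2 f z / f z) z := by
  have h0 := (hpos _ hz).ne'
  refine ((hasDerivAt_deriv_one hIo hf hz).fun_div
    (hasDerivAt_deriv_zero hIo hf hz) h0).fun_neg.congr_deriv ?_
  field_simp
  ring

/-- The tangential coefficient is `m - 1`, against `3` in the rough Laplacian; their difference `4 -
m` is what singles out dimension four. -/
lemma sum_curvatureOp_hyperplane (hIo : IsOpen I) (hf : ContDiffOn ℝ ∞ f I)
    (hpos : ∀ z ∈ I, 0 < f z) (hx : x ∈ hyperplaneDomain a c I) :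
    ∑ i, ∑ j, (pullbackMetric (conformalMetric m f) (hyperplane a c) x)⁻¹ i j
        • curvatureOp (conformalMetric m f) (hyperplane a c x) (dmap (hyperplane a c) i x)
          (tension (pullbackMetric (conformalMetric m f) (hyperplane a c)) (conformalMetric m f)
            (hyperplane a c) x) (dmap (hyperplane a c) j x)
      = (-(m * (1 + ∑ i, a i ^ 2)⁻¹ ^ 2 * f (height a c x)))
        • ((-((∑ i, a i ^ 2) + m) * f (height a c x) * deriv f (height a c x)
              * iteratedDeriv 2 f (height a c x)
            + m * (1 + ∑ i, a i ^ 2) * deriv f (height a c x) ^ 3) • normalVec a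
          + ((m - 1) * f (height a c x) * deriv f (height a c x)
              * iteratedDeriv 2 f (height a c x)) • ∑ i, a i • tangentVec a i) := by
  have hf0 := hasDerivAt_deriv_zero hIo hf hx
  have h0 := (hpos _ hx).ne'
  have hl := hyperplane_last a c x
  have hz : hyperplane a c x (Fin.last m) ∈ I := by rw [hl]; exact hx
  have hev : ∀ᶠ z in 𝓝 (hyperplane a c x (Fin.last m)), DifferentiableAt ℝ f z ∧ f z ≠ 0 :=
    Filter.Eventually.mono (hIo.mem_nhds hz) fun z hz =>
      ⟨(hasDerivAt_deriv_zero hIo hf hz).differentiableAt, (hpos z hz).ne'⟩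
  have hSpos := (one_add_sum_sq_pos a).ne'
  funext α
  have hE := sum_mul_tangentVec a α
  simp only [Finset.sum_apply, Pi.smul_apply, smul_eq_mul, dmap_hyperplane,
    tension_hyperplane hf0.differentiableAt h0, inv_pullbackMetric_hyperplane h0,
    curvatureOp_conformalMetric hev (hasDerivAt_neg_logDeriv hIo hf hpos hz), hl,
    smul_dotProduct, dotProduct_comm (normalVec a), tangentVec_dotProduct_normalVec,
    tangentVec_last, normalVec_last, tangentVec_dotProduct, ← euclidGram_apply, Pi.add_apply]
  set S := ∑ i, a i ^ 2 with hS
  set z := height a c x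
  set ε : ℝ := if α = Fin.last m then 1 else 0 with hε
  have hE' : (∑ i, a i * tangentVec a i α) = normalVec a α + (1 + S) * ε := by
    rw [hE, hε]; split_ifs <;> ring
  have hterm : ∀ i j, f z ^ 2 * euclidGramInv a i j *
      (((deriv f z / f z) ^ 2 - ((deriv f z / f z) ^ 2 - iteratedDeriv 2 f z / f z))
          * (tangentVec a i α * (-(m * (1 + S)⁻¹) * (f z * deriv f z) * -1) * a j
            - -(m * (1 + S)⁻¹) * (f z * deriv f z) * normalVec a α * a i * a j
            + (a i * (-(m * (1 + S)⁻¹) * (f z * deriv f z) * 0)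
              - -(m * (1 + S)⁻¹) * (f z * deriv f z) * -1 * euclidGram a i j) * ε)
        - (deriv f z / f z) ^ 2
          * (-(m * (1 + S)⁻¹) * (f z * deriv f z) * 0 * tangentVec a i α
            - euclidGram a i j * (-(m * (1 + S)⁻¹) * (f z * deriv f z) * normalVec a α)))
      = (-(m * (1 + S)⁻¹) * f z ^ 2) * (euclidGramInv a i j
        * (a i * a j * (-(deriv f z * iteratedDeriv 2 f z) * normalVec a α)
          + a j * tangentVec a i α * (-(deriv f z * iteratedDeriv 2 f z))
          + a i * tangentVec a j α * 0
          + euclidGram a i j * (deriv f z * iteratedDeriv 2 f z * ε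
            + deriv f z ^ 3 / f z * normalVec a α))) := by
    intro i j
    clear_value S z ε
    field_simp
    ring
  simp only [hterm, ← Finset.mul_sum]
  rw [sum_sum_euclidGramInv, ← hS]
  -- The component of `∂_z` is eliminated in favour of the tangential and normal vectors.
  have hε' : ε = (1 + S)⁻¹ * ((∑ i, a i * tangentVec a i α) - normalVec a α) := by
    rw [hE']; field_simp; ring
  rw [hε']
  generalize (∑ i, a i * tangentVec a i α) = E
  clear_value S z
  field_simp
  ring

/-- The bitension field of the hyperplanes. -/
lemma bitension_hyperplane (hIo : IsOpen I) (hf : ContDiffOn ℝ ∞ f I)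
    (hpos : ∀ z ∈ I, 0 < f z) (hx : x ∈ hyperplaneDomain a c I) :
    bitension (pullbackMetric (conformalMetric m f) (hyperplane a c)) (conformalMetric m f)
        (hyperplane a c) x
      = (-(m * (1 + ∑ i, a i ^ 2)⁻¹ ^ 2 * f (height a c x)))
        • (((∑ i, a i ^ 2) * f (height a c x) ^ 2 * iteratedDeriv 3 f (height a c x)
            + (m + (3 - m) * ∑ i, a i ^ 2) * f (height a c x) * deriv f (height a c x)
              * iteratedDeriv 2 f (height a c x)
            - m * (2 + ∑ i, a i ^ 2) * deriv f (height a c x) ^ 3) • normalVec a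
          + ((4 - m) * f (height a c x) * deriv f (height a c x)
              * iteratedDeriv 2 f (height a c x)) • ∑ i, a i • tangentVec a i) := by
  rw [bitension, roughLaplacian_tension_hyperplane hIo hf hpos hx,
    sum_curvatureOp_hyperplane hIo hf hpos hx]
  module

/-- The biharmonic equation of the hyperplanes. -/
lemma bitension_hyperplane_eq_zero_iff (hm : m ≠ 0) (hIo : IsOpen I) (hf : ContDiffOn ℝ ∞ f I)
    (hpos : ∀ z ∈ I, 0 < f z) (hx : x ∈ hyperplaneDomain a c I) :
    bitension (pullbackMetric (conformalMetric m f) (hyperplane a c)) (conformalMetric m f)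
        (hyperplane a c) x = 0 ↔
      ((∑ i, a i ^ 2) * f (height a c x) ^ 2 * iteratedDeriv 3 f (height a c x)
            + (m + (3 - m) * ∑ i, a i ^ 2) * f (height a c x) * deriv f (height a c x)
              * iteratedDeriv 2 f (height a c x)
            - m * (2 + ∑ i, a i ^ 2) * deriv f (height a c x) ^ 3 = 0) ∧
      ((∀ i, a i = 0) ∨ m = 4 ∨ deriv f (height a c x) * iteratedDeriv 2 f (height a c x) = 0) := by
  have h0 := (hpos _ hx).ne'
  have hS := (one_add_sum_sq_pos a).ne'
  have hm' : (m : ℝ) ≠ 0 := Nat.cast_ne_zero.2 hm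
  rw [bitension_hyperplane hIo hf hpos hx, smul_eq_zero, or_iff_right
    (neg_ne_zero.2 (mul_ne_zero (mul_ne_zero hm' (pow_ne_zero 2 (inv_ne_zero hS))) h0))]
  generalize (∑ i, a i ^ 2) * f (height a c x) ^ 2 * iteratedDeriv 3 f (height a c x)
            + (m + (3 - m) * ∑ i, a i ^ 2) * f (height a c x) * deriv f (height a c x)
              * iteratedDeriv 2 f (height a c x)
            - m * (2 + ∑ i, a i ^ 2) * deriv f (height a c x) ^ 3 = D
  have hC : ((∀ i, a i = 0) ∨ m = 4
      ∨ deriv f (height a c x) * iteratedDeriv 2 f (height a c x) = 0) ↔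
      (∀ i, ((4 - m) * f (height a c x) * deriv f (height a c x)
              * iteratedDeriv 2 f (height a c x)) * a i = 0) := by
    have h4 : (4 - (m : ℝ)) = 0 ↔ m = 4 := by
      rw [sub_eq_zero, eq_comm]; norm_cast
    simp only [mul_eq_zero, h0, or_false, h4]
    by_cases h : ∀ i, a i = 0
    · simp [h]
    · obtain ⟨i, hi⟩ := not_forall.1 h
      constructor
      · rintro (h' | h' | h') i
        · exact absurd h' h
        · exact Or.inl (Or.inl (Or.inl h'))
        · tauto
      · intro h'
        have := h' i
        tauto
  rw [hC]
  generalize (4 - m) * f (height a c x) * deriv f (height a c x)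
              * iteratedDeriv 2 f (height a c x) = C
  have hcomp : ∀ α, (D • normalVec a + C • ∑ i, a i • tangentVec a i) α
      = D * normalVec a α
        + C * (normalVec a α + if α = Fin.last m then 1 + ∑ i, a i ^ 2 else 0) := by
    intro α
    simp only [Pi.add_apply, Pi.smul_apply, Finset.sum_apply, smul_eq_mul, sum_mul_tangentVec]
  constructor
  · intro h
    have hl := hcomp (Fin.last m)
    have hi := fun i : Fin m => hcomp i.castSucc
    rw [h] at hl hi
    simp only [Pi.zero_apply, normalVec_last, normalVec_castSucc, Fin.castSucc_ne_last, if_true,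
      if_false, add_zero] at hl hi
    -- The last component gives `D = C S`, the others `(D + C) a i = 0`; together `(1 + S) C a i =
    -- 0`.
    have hD : D = C * ∑ i, a i ^ 2 := by linarith
    have hCa : ∀ i, C * a i = 0 := by
      intro i
      have h1 : (1 + ∑ i, a i ^ 2) * (C * a i) = 0 := by
        have := hi i; rw [hD] at this; linear_combination -this
      exact (mul_eq_zero.1 h1).resolve_left hS
    refine ⟨?_, hCa⟩
    rw [hD, Finset.mul_sum]
    exact Finset.sum_eq_zero fun i _ => by rw [pow_two, ← mul_assoc, hCa, zero_mul]
  · rintro ⟨hD, hCa⟩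
    rw [hD, zero_smul, zero_add, Finset.smul_sum]
    exact Finset.sum_eq_zero fun i _ => by rw [smul_smul, hCa, zero_smul]

end Bitension

/-! ### Solving the biharmonic equations for `f`. -/

section Equation

variable {m : ℕ} {a : Fin m → ℝ} {I : Set ℝ} {f : ℝ → ℝ}

lemma eq_zero_of_hasDerivAt_of_eqOn_zero {g : ℝ → ℝ} {g' z : ℝ} {s : Set ℝ}
    (hg : HasDerivAt g g' z) (hs : s ∈ 𝓝 z) (h : ∀ t ∈ s, g t = 0) : g' = 0 :=
  hg.unique ((hasDerivAt_const z (0 : ℝ)).congr_of_eventuallyEq (Filter.Eventually.mono hs h))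

lemma hasDerivAt_of_caseReciprocal (hIo : IsOpen I) {A B : ℝ}
    (h : ∀ z ∈ I, A * z + B ≠ 0 ∧ f z = 1 / (A * z + B)) {z : ℝ} (hz : z ∈ I) :
    HasDerivAt f (-A * f z ^ 2) z := by
  have h1 : HasDerivAt (fun t => 1 / (A * t + B)) (-A * f z ^ 2) z := by
    have h2 : HasDerivAt (fun t => A * t + B) A z := by
      simpa using ((hasDerivAt_id z).const_mul A).add_const B
    refine ((hasDerivAt_const z (1 : ℝ)).fun_div h2 (h z hz).1).congr_deriv ?_
    rw [(h z hz).2]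
    have := (h z hz).1
    field_simp
    ring
  exact h1.congr_of_eventuallyEq (Filter.Eventually.mono (hIo.mem_nhds hz) fun t ht => (h t ht).2)

/-- With `v = (1 / f)' = -f' / f²`, the hypothesis says `v v' = 0`. -/
lemma caseConst_or_caseReciprocal (hIo : IsOpen I) (hIc : I.OrdConnected)
    (hf : ContDiffOn ℝ ∞ f I) (hpos : ∀ z ∈ I, 0 < f z) (ha : ∀ i, a i = 0)
    (h : ∀ z ∈ I, deriv f z * (f z * iteratedDeriv 2 f z - 2 * deriv f z ^ 2) = 0) :
    CaseConst f I ∨ CaseReciprocal a f I := by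
  have hf0 := fun {z} (hz : z ∈ I) => hasDerivAt_deriv_zero hIo hf hz
  have hf1 := fun {z} (hz : z ∈ I) => hasDerivAt_deriv_one hIo hf hz
  have h0 := fun {z} (hz : z ∈ I) => (hpos z hz).ne'
  have hconn : IsPreconnected I := isPreconnected_iff_ordConnected.2 hIc
  have hconst : ∀ g : ℝ → ℝ, (∀ z ∈ I, HasDerivAt g 0 z) → ∀ y ∈ I, ∀ z ∈ I, g y = g z :=
    fun g hg y hy z hz => hIo.is_const_of_deriv_eq_zero hconn
      (fun t ht => (hg t ht).differentiableAt.differentiableWithinAt)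
      (fun t ht => (hg t ht).deriv) hy hz
  by_cases hall : CaseConst f I
  · exact Or.inl hall
  right
  obtain ⟨z₀, hz₀, hne⟩ : ∃ z ∈ I, deriv f z ≠ 0 := by
    simpa [CaseConst] using hall
  have hv : ∀ z ∈ I, HasDerivAt (fun t => -deriv f t / f t ^ 2)
      (-(f z * iteratedDeriv 2 f z - 2 * deriv f z ^ 2) / f z ^ 3) z := by
    intro z hz
    refine ((hf1 hz).fun_neg.fun_div ((hf0 hz).fun_pow 2)
      (pow_ne_zero 2 (h0 hz))).congr_deriv ?_
    have := h0 hz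
    field_simp
    ring
  -- The factor that vanishes may vary with the point, but `v²` has derivative `2 v v' = 0`
  -- everywhere. Hence `v²` is constant, and `f'` vanishes nowhere once it is nonzero at `z₀`.
  have hsq := hconst (fun t => (-deriv f t / f t ^ 2) ^ 2) fun z hz => by
    refine ((hv z hz).fun_pow 2).congr_deriv ?_
    rcases mul_eq_zero.1 (h z hz) with h1 | h1 <;> simp [h1]
  have hne' : ∀ z ∈ I, deriv f z ≠ 0 := by
    intro z hz hzero
    have h1 := hsq z hz z₀ hz₀
    simp only [hzero, neg_zero, zero_div] at h1
    exact pow_ne_zero 2 (div_ne_zero (neg_ne_zero.2 hne) (pow_ne_zero 2 (h0 hz₀)))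
      (h1.symm.trans (zero_pow two_ne_zero))
  have hslope := hconst (fun t => -deriv f t / f t ^ 2) fun z hz => by
    refine (hv z hz).congr_deriv ?_
    rw [(mul_eq_zero.1 (h z hz)).resolve_left (hne' z hz)]
    simp
  set A := -deriv f z₀ / f z₀ ^ 2 with hA
  have haff := hconst (fun t => 1 / f t - A * t) fun z hz => by
    have h1 := h0 hz
    have h2 := hslope z hz z₀ hz₀
    refine (((hasDerivAt_const z (1 : ℝ)).fun_div (hf0 hz) h1).fun_sub
      ((hasDerivAt_id z).const_mul A)).congr_deriv ?_
    rw [hA, ← h2]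
    simp
  refine ⟨ha, A, 1 / f z₀ - A * z₀, ?_, fun z hz => ?_⟩
  · exact div_ne_zero (neg_ne_zero.2 hne) (pow_ne_zero 2 (h0 hz₀))
  · have h1 : A * z + (1 / f z₀ - A * z₀) = 1 / f z := by
      have := haff z hz z₀ hz₀
      linarith
    rw [h1]
    exact ⟨one_div_ne_zero (h0 hz), (one_div_one_div _).symm⟩

/-- Solution of the equations expressing biharmonicity of all hyperplanes. -/
lemma forall_biharmonic_equation_iff (hm : m ≠ 0) (hIo : IsOpen I) (hIc : I.OrdConnected)
    (hf : ContDiffOn ℝ ∞ f I) (hpos : ∀ z ∈ I, 0 < f z) :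
    (∀ z ∈ I, (∑ i, a i ^ 2) * f z ^ 2 * iteratedDeriv 3 f z
            + (m + (3 - m) * ∑ i, a i ^ 2) * f z * deriv f z * iteratedDeriv 2 f z
            - m * (2 + ∑ i, a i ^ 2) * deriv f z ^ 3 = 0 ∧
      ((∀ i, a i = 0) ∨ m = 4 ∨ deriv f z * iteratedDeriv 2 f z = 0)) ↔
    CaseConst f I ∨ CaseODE a f I ∨ CaseReciprocal a f I := by
  have hm' : (m : ℝ) ≠ 0 := Nat.cast_ne_zero.2 hm
  have hf1 := fun {z} (hz : z ∈ I) => hasDerivAt_deriv_one hIo hf hz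
  have hf2 := fun {z} (hz : z ∈ I) => hasDerivAt_iteratedDeriv hIo hf hz 2
  constructor
  · intro h
    by_cases ha : ∀ i, a i = 0
    · refine (caseConst_or_caseReciprocal hIo hIc hf hpos ha fun z hz => ?_).imp_right Or.inr
      have h1 := (h z hz).1
      simp only [ha, ne_eq, OfNat.ofNat_ne_zero, not_false_eq_true, zero_pow,
        Finset.sum_const_zero] at h1
      refine (mul_eq_zero.1 ?_).resolve_left hm'
      linear_combination h1
    by_cases h4 : m = 4
    · refine Or.inr (Or.inl ⟨h4, fun z hz => ?_⟩)
      have h1 := (h z hz).1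
      have h5 : (m : ℝ) = 4 := by exact_mod_cast h4
      rw [h5] at h1
      linear_combination h1
    · refine Or.inl fun z hz => ?_
      by_contra hne
      have hmul : ∀ t ∈ I, deriv f t * iteratedDeriv 2 f t = 0 := fun t ht => by
        simpa [ha, h4] using (h t ht).2
      -- On this neighbourhood `f'' = 0`, hence also `f''' = 0` at `z`, and the normal equation
      -- reduces to `m (2 + S) f'³ = 0`.
      have hnhds : {t | t ∈ I ∧ deriv f t ≠ 0} ∈ 𝓝 z :=
        Filter.inter_mem (hIo.mem_nhds hz) ((hf1 hz).continuousAt.eventually_ne hne)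
      have h3 : iteratedDeriv 3 f z = 0 :=
        eq_zero_of_hasDerivAt_of_eqOn_zero (hf2 hz) hnhds fun t ht =>
          (mul_eq_zero.1 (hmul t ht.1)).resolve_left ht.2
      have h2 : iteratedDeriv 2 f z = 0 := (mul_eq_zero.1 (hmul z hz)).resolve_left hne
      have h1 := (h z hz).1
      have hS : (2 + ∑ i, a i ^ 2) ≠ 0 := by positivity
      rw [h3, h2] at h1
      simp [hm', hS, hne] at h1
  · rintro (h | ⟨h4, h⟩ | ⟨ha, A, B, hA, h⟩) z hz
    · have h2 : ∀ t ∈ I, iteratedDeriv 2 f t = 0 := fun t ht =>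
        eq_zero_of_hasDerivAt_of_eqOn_zero (hf1 ht) (hIo.mem_nhds ht) h
      have h3 : iteratedDeriv 3 f z = 0 :=
        eq_zero_of_hasDerivAt_of_eqOn_zero (hf2 hz) (hIo.mem_nhds hz) h2
      simp [h z hz, h3]
    · refine ⟨?_, Or.inr (Or.inl h4)⟩
      have h5 : (m : ℝ) = 4 := by exact_mod_cast h4
      rw [h5]
      linear_combination h z hz
    · refine ⟨?_, Or.inl ha⟩
      have hd : ∀ t ∈ I, HasDerivAt f (-A * f t ^ 2) t := fun t ht =>
        hasDerivAt_of_caseReciprocal hIo h ht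
      have h2 : iteratedDeriv 2 f z = 2 * A ^ 2 * f z ^ 3 := by
        have h3 : HasDerivAt (deriv f) (2 * A ^ 2 * f z ^ 3) z := by
          have h4 := (((hd z hz).fun_pow 2).const_mul (-A)).congr_of_eventuallyEq
            (Filter.Eventually.mono (hIo.mem_nhds hz) fun t ht => (hd t ht).deriv)
          refine h4.congr_deriv ?_
          push_cast
          ring
        exact (hf1 hz).unique h3
      simp only [ha, ne_eq, OfNat.ofNat_ne_zero, not_false_eq_true, zero_pow,
        Finset.sum_const_zero, (hd z hz).deriv, h2]
      ring

end Equation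

/-! ### Smoothness, attained heights, umbilicity and the unit normal. -/

section Hyperplane

variable {m : ℕ} {a : Fin m → ℝ} {c : ℝ} {f : ℝ → ℝ} {x : Fin m → ℝ}

lemma contDiff_hyperplane : ContDiff ℝ ∞ (hyperplane a c) := by
  rw [contDiff_pi]
  refine Fin.lastCases ?_ fun j => ?_
  · simp only [hyperplane_last]
    unfold height
    fun_prop
  · simp only [hyperplane, Fin.snoc_castSucc]
    fun_prop

lemma height_zero : height a c 0 = c := by simp [height]

lemma exists_height_eq {i : Fin m} (hi : a i ≠ 0) (z : ℝ) : ∃ x, height a c x = z :=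
  ⟨Pi.single i ((z - c) / a i), by
    simp [height, Pi.single_apply, mul_div_cancel₀ _ hi]⟩

lemma meanCurvatureVector_hyperplane (hm : m ≠ 0) (hf : DifferentiableAt ℝ f (height a c x))
    (h0 : f (height a c x) ≠ 0) :
    meanCurvatureVector (conformalMetric m f) (hyperplane a c) x
      = (-(1 + ∑ i, a i ^ 2)⁻¹ * (f (height a c x) * deriv f (height a c x))) • normalVec a := by
  have hm' : (m : ℝ) ≠ 0 := Nat.cast_ne_zero.2 hm
  rw [meanCurvatureVector, tension_hyperplane hf h0, smul_smul, Fintype.card_fin]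
  congr 1
  field_simp

lemma normalFactor_sq : normalFactor a ^ 2 = (1 + ∑ i, a i ^ 2)⁻¹ := by
  rw [normalFactor, div_pow, Real.sq_sqrt (one_add_sum_sq_pos a).le, one_pow, one_div]

lemma hyperplaneNormal_eq (z : ℝ) :
    hyperplaneNormal a f z = (normalFactor a * f z) • normalVec a := rfl

lemma isTotallyUmbilicalOn_hyperplane (hm : m ≠ 0) {U : Set (Fin m → ℝ)}
    (hU : ∀ x ∈ U, DifferentiableAt ℝ f (height a c x) ∧ f (height a c x) ≠ 0) :
    IsTotallyUmbilicalOn (conformalMetric m f) (hyperplane a c) U := by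
  intro x hx i j
  obtain ⟨hf, h0⟩ := hU x hx
  rw [secondFundForm_hyperplane hf h0, meanCurvatureVector_hyperplane hm hf h0, smul_smul,
    pullbackMetric_hyperplane]
  congr 1
  simp only [Matrix.smul_apply, smul_eq_mul]
  field_simp

lemma isUnitNormalAt_hyperplane (h0 : f (height a c x) ≠ 0) :
    IsUnitNormalAt (conformalMetric m f) (hyperplane a c) x
      (hyperplaneNormal a f (height a c x)) := by
  have hS := (one_add_sum_sq_pos a).ne'
  refine ⟨?_, fun i => ?_⟩
  · rw [sum_sum_conformalMetric, hyperplaneNormal_eq, hyperplane_last, smul_dotProduct,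
      dotProduct_smul, normalVec_dotProduct, smul_eq_mul, smul_eq_mul]
    have h : normalFactor a ^ 2 * (1 + ∑ i, a i ^ 2) = 1 := by
      rw [normalFactor_sq, inv_mul_cancel₀ hS]
    field_simp
    linear_combination h
  · rw [sum_sum_conformalMetric, hyperplaneNormal_eq, dmap_hyperplane, smul_dotProduct,
      dotProduct_comm, tangentVec_dotProduct_normalVec, smul_zero, mul_zero]

lemma normalVec_ne_zero : normalVec a ≠ 0 := fun h => by
  simpa using congrFun h (Fin.last m)

end Hyperplane

end BiharmonicMap

/-! ### Assembly of the theorem. -/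

theorem theorem2p2 (m : ℕ) (hm : 2 ≤ m) (a : Fin m → ℝ)
    (I : Set ℝ) (hIo : IsOpen I) (hIc : I.OrdConnected)
    (f : ℝ → ℝ) (hf : ContDiffOn ℝ ∞ f I) (hpos : ∀ z ∈ I, 0 < f z) :
    -- a single hyperplane which is not horizontal
    ((∃ i, a i ≠ 0) → ∀ c : ℝ,
      (IsBiharmonicOn (pullbackMetric (conformalMetric m f) (hyperplane a c))
          (conformalMetric m f) (hyperplane a c) (hyperplaneDomain a c I)
        ↔ CaseConst f I ∨ CaseODE a f I ∨ CaseReciprocal a f I)) ∧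
    -- the family of all parallel hyperplanes, horizontal or not
    ((∀ c : ℝ, IsBiharmonicOn (pullbackMetric (conformalMetric m f) (hyperplane a c))
          (conformalMetric m f) (hyperplane a c) (hyperplaneDomain a c I))
        ↔ CaseConst f I ∨ CaseODE a f I ∨ CaseReciprocal a f I) ∧
    -- constant `f` gives minimal, even totally geodesic hyperplanes
    (CaseConst f I → ∀ c : ℝ,
      IsHarmonicOn (pullbackMetric (conformalMetric m f) (hyperplane a c))
          (conformalMetric m f) (hyperplane a c) (hyperplaneDomain a c I) ∧
      IsTotallyGeodesicOn (pullbackMetric (conformalMetric m f) (hyperplane a c))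
          (conformalMetric m f) (hyperplane a c) (hyperplaneDomain a c I)) ∧
    -- the reciprocal case gives proper biharmonic hyperplanes
    (CaseReciprocal a f I → ∀ c ∈ I,
      IsProperBiharmonicOn (pullbackMetric (conformalMetric m f) (hyperplane a c))
          (conformalMetric m f) (hyperplane a c) (hyperplaneDomain a c I)) ∧
    -- each hyperplane is totally umbilical, with mean curvature `H = -k_m f'`
    (∀ c : ℝ,
      IsTotallyUmbilicalOn (conformalMetric m f) (hyperplane a c) (hyperplaneDomain a c I) ∧
      ∀ x ∈ hyperplaneDomain a c I,
        IsUnitNormalAt (conformalMetric m f) (hyperplane a c) x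
          (hyperplaneNormal a f (height a c x)) ∧
        meanCurvatureVector (conformalMetric m f) (hyperplane a c) x
          = (-(normalFactor a) * deriv f (height a c x)) •
            hyperplaneNormal a f (height a c x)) := by
  have hm0 : m ≠ 0 := by omega
  have hreg : ∀ z ∈ I, DifferentiableAt ℝ f z ∧ f z ≠ 0 := fun z hz =>
    ⟨(hasDerivAt_deriv_zero hIo hf hz).differentiableAt, (hpos z hz).ne'⟩
  have hbi : ∀ c : ℝ, IsBiharmonicOn (pullbackMetric (conformalMetric m f) (hyperplane a c))
          (conformalMetric m f) (hyperplane a c) (hyperplaneDomain a c I) ↔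
        ∀ x ∈ hyperplaneDomain a c I,
          (∑ i, a i ^ 2) * f (height a c x) ^ 2 * iteratedDeriv 3 f (height a c x)
            + (m + (3 - m) * ∑ i, a i ^ 2) * f (height a c x) * deriv f (height a c x)
              * iteratedDeriv 2 f (height a c x)
            - m * (2 + ∑ i, a i ^ 2) * deriv f (height a c x) ^ 3 = 0 ∧
          ((∀ i, a i = 0) ∨ m = 4
            ∨ deriv f (height a c x) * iteratedDeriv 2 f (height a c x) = 0) := fun c =>
    (and_iff_right contDiff_hyperplane.contDiffOn).trans
      (forall₂_congr fun x hx => bitension_hyperplane_eq_zero_iff hm0 hIo hf hpos hx)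
  have hall : (∀ c : ℝ, IsBiharmonicOn (pullbackMetric (conformalMetric m f) (hyperplane a c))
          (conformalMetric m f) (hyperplane a c) (hyperplaneDomain a c I))
        ↔ CaseConst f I ∨ CaseODE a f I ∨ CaseReciprocal a f I := by
    rw [← forall_biharmonic_equation_iff hm0 hIo hIc hf hpos]
    constructor
    · intro h z hz
      -- The hyperplane with `c = z` has height `z` at the origin, which reaches every `z` in `I`
      -- even when `a = 0`.
      have := (hbi z).1 (h z) 0 (by simpa [hyperplaneDomain, height_zero] using hz)
      rwa [height_zero] at this
    · exact fun h c => (hbi c).2 fun x hx => h _ hx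
  refine ⟨?_, hall, ?_, ?_, ?_⟩
  · rintro ⟨i, hi⟩ c
    rw [← forall_biharmonic_equation_iff hm0 hIo hIc hf hpos, hbi c]
    constructor
    · intro h z hz
      obtain ⟨x, rfl⟩ := exists_height_eq (c := c) hi z
      exact h x hz
    · exact fun h x hx => h _ hx
  · intro h c
    refine ⟨⟨contDiff_hyperplane.contDiffOn, fun x hx => ?_⟩, fun x hx i j => ?_⟩
    · obtain ⟨h1, h2⟩ := hreg _ hx
      rw [tension_hyperplane h1 h2, h _ hx, mul_zero, mul_zero, zero_smul]
    · obtain ⟨h1, h2⟩ := hreg _ hx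
      rw [secondFundForm_hyperplane h1 h2, h _ hx, zero_div, neg_zero, zero_mul, zero_mul,
        zero_smul]
  · intro h c hc
    refine ⟨hall.2 (Or.inr (Or.inr h)) c, fun hh => ?_⟩
    obtain ⟨-, A, B, hA, h⟩ := h
    -- At the origin the height is `c`, where `f' = -A f²` is nonzero, so the tension does not
    -- vanish there.
    have ht := hh.2 0 (by simpa [hyperplaneDomain, height_zero] using hc)
    have h0 := (hreg c hc).2
    have hm' : (m : ℝ) ≠ 0 := Nat.cast_ne_zero.2 hm0
    have hS := (one_add_sum_sq_pos a).ne'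
    rw [tension_hyperplane (by simpa [height_zero] using (hreg c hc).1)
      (by simpa [height_zero] using h0), height_zero,
      (hasDerivAt_of_caseReciprocal hIo h hc).deriv, smul_eq_zero] at ht
    refine ht.elim ?_ normalVec_ne_zero
    simp [hm', hS, h0, hA]
  · intro c
    refine ⟨isTotallyUmbilicalOn_hyperplane hm0 fun x hx => hreg _ hx, fun x hx => ?_⟩
    obtain ⟨h1, h2⟩ := hreg _ hx
    refine ⟨isUnitNormalAt_hyperplane h2, ?_⟩
    -- The factor `(1 + S)⁻¹` is the square of `normalFactor a`: one copy goes into `H`, the other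
    -- into the unit normal.
    rw [meanCurvatureVector_hyperplane hm0 h1 h2, hyperplaneNormal_eq, smul_smul,
      ← normalFactor_sq]
    congr 1
    ring
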